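/- For $m\ge 1$ let $D_m=\langle x,y\mid x^2=y^{2^m}=1,\ yx=xy^{-1}\rangle$ be the dihedral group of order $2^{m+1}$ (so $D_1$ is the Klein four group); for $m\ge 3$ let $SD_m=\langle x,y\mid x^2=y^{2^m}=1,\ yx=xy^{2^{m-1}-1}\rangle$ be the semi-dihedral group of order $2^{m+1}$; and for $m\ge 2$ let $Q_m=\langle x,y\mid x^2=y^{2^{m-1}},\ yx=xy^{-1}\rangle$ be the generalized quaternion group of order $2^{m+1}$. Let $\mathbb{F}$ be a field of characteristic $2$, and let $Q$ be a finite group whose Sylow $2$-subgroup is dihedral, semi-dihedral or generalized quaternion, i.e. isomorphic to $D_m$ for some $m\ge 1$, to $SD_m$ for some $m\ge 3$, or to $Q_m$ for some $m\ge 2$. Then for every $\mathbb{F}Q$-module $M$ (of finite or infinite dimension, dimensions being cardinals in the latter case), $$\dim_{\mathbb{F}} H^2(Q,M)\ \le\ 3\,\dim_{\mathbb{F}} M .$$ -/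

import Mathlib

universe u

/-- The defining relators of the semi-dihedral group of order `2 ^ (m + 1)` on the generators
`x = of 0` and `y = of 1`, namely `x ^ 2 = 1`, `y ^ (2 ^ m) = 1` and
`y * x = x * y ^ (2 ^ (m - 1) - 1)`. Only `3 ≤ m` is relevant. -/
def semidihedralRels (m : ℕ) : Set (FreeGroup (Fin 2)) :=
  let x : FreeGroup (Fin 2) := FreeGroup.of 0
  let y : FreeGroup (Fin 2) := FreeGroup.of 1
  {x ^ 2, y ^ (2 ^ m), (y * x) * (x * y ^ (2 ^ (m - 1) - 1))⁻¹}

/-- The group `⟨x, y ∣ x ^ 2 = y ^ (2 ^ m) = 1, y x = x y ^ (2 ^ (m - 1) - 1)⟩`; for `3 ≤ m`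
this is the semi-dihedral group of order `2 ^ (m + 1)`. -/
abbrev SemidihedralGroup (m : ℕ) : Type := PresentedGroup (semidihedralRels m)

/-- `P` is a dihedral 2-group: dihedral of order `2 ^ (m + 1)` for some `m ≥ 1`
(for `m = 1` this is the Klein four group). -/
def IsDihedralTwoGroup (P : Type*) [Group P] : Prop :=
  ∃ m : ℕ, 1 ≤ m ∧ Nonempty (P ≃* DihedralGroup (2 ^ m))

/-- `P` is a semi-dihedral 2-group: semi-dihedral of order `2 ^ (m + 1)` for some `m ≥ 3`. -/
def IsSemidihedralTwoGroup (P : Type*) [Group P] : Prop :=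
  ∃ m : ℕ, 3 ≤ m ∧ Nonempty (P ≃* SemidihedralGroup m)

/-- `P` is a generalized quaternion 2-group: of the form
`⟨x, y ∣ x ^ 2 = y ^ (2 ^ (m - 1)), y x = x y⁻¹⟩`, of order `2 ^ (m + 1)`, for some `m ≥ 2`.
Mathlib's `QuaternionGroup n` has order `4 * n`. -/
def IsGeneralizedQuaternionTwoGroup (P : Type*) [Group P] : Prop :=
  ∃ m : ℕ, 2 ≤ m ∧ Nonempty (P ≃* QuaternionGroup (2 ^ (m - 1)))

/-! The index of the Sylow subgroup `P` is odd, hence invertible in `F`, so restriction of `H²` from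
`Q` to `P` is injective (`exists_coboundary_of_subgroup`).

A two-cocycle on `P` defines an extension of `P` by `M`. Lift the generators of a presentation of
`P`: each relator then evaluates to an element of `M`, and if all these values are trivial the lifts
define a splitting. The values depend linearly on the cocycle (`exists_linearMap_of_presentation`),
so three relators make `H²(Q, M)` a subquotient of `M³`. All three families have presentations with
two generators and three relators. -/

/-! ### Restriction to a subgroup of invertible index -/

/-- If a two-cocycle becomes a coboundary on a subgroup of finite invertible index, it is a
coboundary. -/
theorem exists_coboundary_of_subgroup {k G V : Type*} [Field k] [Group G] [AddCommGroup V]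
    [Module k V] (ρ : Representation k G V) (H : Subgroup G) [Finite (G ⧸ H)]
    (hH : (H.index : k) ≠ 0) (f : G → G → V)
    (hf : ∀ g h j, f (g * h) j + f g h = ρ g (f h j) + f g (h * j))
    (φ : H → V) (hφ : ∀ p q : H, f p q = ρ p (φ q) - φ (p * q) + φ p) :
    ∃ ψ : G → V, ∀ g h, f g h = ρ g (ψ h) - ψ (g * h) + ψ g := by
  classical
  have : Fintype (G ⧸ H) := Fintype.ofFinite _
  let t : G → G := fun g => ((g : G ⧸ H).out : G)
  have ht : ∀ g, (t g)⁻¹ * g ∈ H := fun g => QuotientGroup.eq.1 (QuotientGroup.out_eq' _)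
  let q : G → H := fun g => ⟨(t g)⁻¹ * g, ht g⟩
  have htq : ∀ g, t g * q g = g := fun g => mul_inv_cancel_left _ _
  have htp : ∀ g (p : H), t (g * p) = t g := fun g p => by
    simp only [t, QuotientGroup.mk_mul_of_mem g p.2]
  have hqp : ∀ g (p : H), q (g * p) = q g * p := fun g p => by
    ext; simp only [q, htp, Subgroup.coe_mul, mul_assoc]
  -- This is the solution of `h1` that vanishes on the transversal: take `t g` and `q g` for `g` and
  -- `p` there.
  let ψ : G → V := fun g => ρ (t g) (φ (q g)) - f (t g) (q g)
  have h1 : ∀ g (p : H), f g p = ρ g (φ p) - ψ (g * p) + ψ g := by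
    intro g p
    have e := hf (t g) (q g) p
    rw [htq, hφ] at e
    simp only [ψ, htp, hqp]
    simp only [map_add, map_sub, ← Module.End.mul_apply, ← map_mul, htq] at e
    rw [Subgroup.coe_mul, eq_sub_of_add_eq e]
    abel
  let u : G → G → V := fun g h => f g h - ρ g (ψ h) + ψ (g * h)
  have hu : ∀ g h (p : H), u g (h * p) = u g h := by
    intro g h p
    have e := hf g h p
    rw [h1, h1] at e
    simp only [map_add, map_sub, ← Module.End.mul_apply, ← map_mul] at e
    simp only [u, ← mul_assoc]
    rw [← sub_eq_zero] at e ⊢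
    rw [← neg_eq_zero, ← e]
    abel
  have hu' : ∀ g h h' : G, (h : G ⧸ H) = (h' : G ⧸ H) → u g h = u g h' := by
    intro g h h' hh
    have := hu g h ⟨h⁻¹ * h', QuotientGroup.eq.1 hh⟩
    simpa using this.symm
  -- For fixed `j`, `f` is the coboundary of `u · j` except that the last term has `h * j` in place
  -- of `j`. Since `u g` descends to `G ⧸ H`, summing over cosets removes this shift.
  have h2 : ∀ g h j, f g h = ρ g (u h j) - u (g * h) j + u g (h * j) := by
    intro g h j
    have e := hf g h j
    simp only [u, map_add, map_sub, ← Module.End.mul_apply, ← map_mul, ← mul_assoc]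
    rw [← sub_eq_zero] at e ⊢
    rw [← e]
    abel
  let S : G → V := fun g => ∑ c : G ⧸ H, u g c.out
  have hS : ∀ g h, ∑ c : G ⧸ H, u g (h * c.out) = S g := by
    intro g h
    refine Fintype.sum_equiv (MulAction.toPerm h) _ _ fun c => hu' _ _ _ ?_
    rw [MulAction.toPerm_apply, QuotientGroup.out_eq', ← smul_eq_mul, ← MulAction.Quotient.smul_mk,
      QuotientGroup.out_eq']
  have h3 : ∀ g h, (H.index : k) • f g h = ρ g (S h) - S (g * h) + S g := by
    intro g h
    have : ∑ _c : G ⧸ H, f g h = ρ g (S h) - S (g * h) + S g := by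
      rw [Finset.sum_congr rfl fun (c : G ⧸ H) _ => h2 g h c.out, Finset.sum_add_distrib,
        Finset.sum_sub_distrib, hS, ← map_sum]
    rw [← this, Finset.sum_const, Finset.card_univ, Nat.cast_smul_eq_nsmul, Subgroup.index,
      Nat.card_eq_fintype_card]
  refine ⟨fun g => (H.index : k)⁻¹ • S g, fun g h => ?_⟩
  rw [map_smul, ← smul_sub, ← smul_add, ← h3, inv_smul_smul₀ hH]

/-! ### Extensions and evaluation of relators -/

/-- The extension of `G` by the representation `V` given by a two-cocycle `f`. -/
@[ext]
structure CocycleExtension {k G V : Type*} [Field k] [Group G] [AddCommGroup V] [Module k V]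
    (ρ : Representation k G V) (f : G → G → V) where
  /-- The component in the representation. -/
  left : V
  /-- The component in the group. -/
  right : G

namespace CocycleExtension

variable {k G V : Type*} [Field k] [Group G] [AddCommGroup V] [Module k V]
  {ρ : Representation k G V} {f : G → G → V}

instance : Mul (CocycleExtension ρ f) :=
  ⟨fun a b => ⟨a.left + ρ a.right b.left + f a.right b.right, a.right * b.right⟩⟩

/-- Cocycles are not assumed normalized, so the identity carries the correction `-f 1 1`. -/
instance : One (CocycleExtension ρ f) := ⟨⟨-f 1 1, 1⟩⟩

instance : Inv (CocycleExtension ρ f) :=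
  ⟨fun a => ⟨-f 1 1 - f a.right⁻¹ a.right - ρ a.right⁻¹ a.left, a.right⁻¹⟩⟩

@[simp] theorem mul_left (a b : CocycleExtension ρ f) :
    (a * b).left = a.left + ρ a.right b.left + f a.right b.right := rfl

@[simp] theorem mul_right (a b : CocycleExtension ρ f) : (a * b).right = a.right * b.right := rfl

@[simp] theorem one_left : (1 : CocycleExtension ρ f).left = -f 1 1 := rfl

@[simp] theorem one_right : (1 : CocycleExtension ρ f).right = 1 := rfl

@[simp] theorem inv_left (a : CocycleExtension ρ f) :
    a⁻¹.left = -f 1 1 - f a.right⁻¹ a.right - ρ a.right⁻¹ a.left := rfl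

@[simp] theorem inv_right (a : CocycleExtension ρ f) : a⁻¹.right = a.right⁻¹ := rfl

/-- The group structure on the extension given by a two-cocycle. -/
abbrev group (hf : ∀ g h j, f (g * h) j + f g h = ρ g (f h j) + f g (h * j)) :
    Group (CocycleExtension ρ f) :=
  Group.ofLeftAxioms
    (fun a b c => by
      ext
      · have := hf a.right b.right c.right
        simp only [mul_left, mul_right, map_add, map_mul, Module.End.mul_apply]
        rw [← sub_eq_zero] at this ⊢
        rw [← this]
        abel
      · exact mul_assoc _ _ _)
    (fun a => by
      ext
      · have := hf 1 1 a.right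
        simp only [one_mul, map_one, Module.End.one_apply, add_right_inj] at this
        simp [← this]
      · exact one_mul _)
    (fun a => by
      ext
      · simp
      · exact inv_mul_cancel _)

end CocycleExtension

open CocycleExtension in
/-- For a group presented with relators `r i`, evaluating the relators in extensions bounds the
second cohomology: a linear family `u` of two-cocycles has a linear map to `ι → V` whose kernel
consists of coboundaries. -/
theorem exists_linearMap_of_presentation {k G V N α ι : Type*} [Field k] [Group G]
    [AddCommGroup V] [Module k V] [AddCommGroup N] [Module k N] {r : ι → FreeGroup α}
    (e : G ≃* PresentedGroup (Set.range r)) (ρ : Representation k G V)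
    (u : G → G → N →ₗ[k] V)
    (hu : ∀ n g h j, u (g * h) j n + u g h n = ρ g (u h j n) + u g (h * j) n) :
    ∃ L : N →ₗ[k] (ι → V), ∀ n, L n = 0 →
      ∃ φ : G → V, ∀ g h, u g h n = ρ g (φ h) - φ (g * h) + φ g := by
  -- Treating `u` as a single cocycle with values in `N →ₗ[k] V` handles all `n` in one extension
  -- and makes `L` linear by construction.
  let σ : Representation k G (N →ₗ[k] V) :=
    { toFun := fun g => LinearMap.compRight k (ρ g)
      map_one' := by ext; simp
      map_mul' := fun g h => by ext; simp }
  have hσ : ∀ g h j, u (g * h) j + u g h = σ g (u h j) + u g (h * j) := fun g h j =>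
    LinearMap.ext fun n => hu n g h j
  let x : α → G := fun a => e.symm (PresentedGroup.of a)
  let _ := group hσ
  let w : FreeGroup α →* CocycleExtension σ u := FreeGroup.lift fun a => ⟨0, x a⟩
  -- The summand `u 1 1` cancels the left component of the identity, so `L n = 0` says that the
  -- relators die in the extension given by `n`.
  refine ⟨LinearMap.pi fun i => (w (r i)).left + u 1 1, fun n hn => ?_⟩
  let _ : Group (CocycleExtension ρ fun g h => u g h n) := group (hu n)
  let T : CocycleExtension σ u →* CocycleExtension ρ fun g h => u g h n :=
    MonoidHom.mk' (fun a => ⟨a.left n, a.right⟩) fun a b => by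
      ext <;> simp [σ]
  let π : CocycleExtension ρ (fun g h => u g h n) →* G := MonoidHom.mk' right fun _ _ => rfl
  have hw : ∀ i, π (T (w (r i))) = 1 := by
    intro i
    have : (π.comp T).comp w =
        (e.symm.toMonoidHom).comp (PresentedGroup.mk (Set.range r)) := by
      ext a
      simp only [w, MonoidHom.comp_apply, FreeGroup.lift_apply_of]
      rfl
    have h := DFunLike.congr_fun this (r i)
    refine h.trans ?_
    have h1 : PresentedGroup.mk (Set.range r) (r i) = 1 := PresentedGroup.one_of_mem ⟨i, rfl⟩
    simp [h1]
  have hlift : ∀ s ∈ Set.range r,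
      FreeGroup.lift (fun a => T (w (FreeGroup.of a))) s = 1 := by
    rintro _ ⟨i, rfl⟩
    have : FreeGroup.lift (fun a => T (w (FreeGroup.of a))) = T.comp w := by
      ext a : 1; simp
    rw [this]
    ext
    · have := congrFun hn i
      simp only [LinearMap.pi_apply, LinearMap.add_apply, Pi.zero_apply] at this
      exact eq_neg_of_add_eq_zero_left this
    · exact hw i
  let s : G →* CocycleExtension ρ fun g h => u g h n :=
    (PresentedGroup.toGroup hlift).comp e.toMonoidHom
  have hs : ∀ g, (s g).right = g := by
    have : π.comp (PresentedGroup.toGroup hlift) = e.symm.toMonoidHom := by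
      refine PresentedGroup.ext fun a => ?_
      simp only [MonoidHom.comp_apply, PresentedGroup.toGroup.of, w, FreeGroup.lift_apply_of]
      rfl
    intro g
    have h := DFunLike.congr_fun this (e g)
    exact h.trans (e.symm_apply_apply g)
  refine ⟨fun g => -(s g).left, fun g h => ?_⟩
  have := congrArg left (map_mul s g h)
  simp only [mul_left, hs] at this
  simp only [this, map_neg]
  abel

/-! ### Presentations of the three families -/

/-- Exponents of `y` may be read modulo `n`; this supplies the cyclic part of homomorphisms out of
both groups. -/
theorem exists_zmod_powers_hom {E : Type*} [Group E] {n : ℕ} {y : E} (hy : y ^ n = 1) :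
    ∃ c : ZMod n → E, (∀ i j, c (i + j) = c i * c j) ∧ c 1 = y ∧ ∀ k : ℕ, c k = y ^ k := by
  let l : ZMod n →+ Additive E :=
    ZMod.lift n ⟨zmultiplesHom (Additive E) (Additive.ofMul y), by
      rw [zmultiplesHom_apply, natCast_zsmul, ← ofMul_pow, hy, ofMul_one]⟩
  have hk : ∀ k : ℕ, (l k).toMul = y ^ k := fun k => by
    have := ZMod.lift_coe n ⟨zmultiplesHom (Additive E) (Additive.ofMul y), by
      rw [zmultiplesHom_apply, natCast_zsmul, ← ofMul_pow, hy, ofMul_one]⟩ (k : ℤ)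
    simp only [Int.cast_natCast] at this
    simp [l, this]
  refine ⟨fun i => (l i).toMul, fun i j => by simp, by simpa using hk 1, hk⟩

theorem zmod_powers_mul_of_inverts {E : Type*} [Group E] {n : ℕ} [NeZero n] {x y : E}
    (hxy : y * x = x * y⁻¹) {c : ZMod n → E} (hc : ∀ i j, c (i + j) = c i * c j)
    (hk : ∀ k : ℕ, c k = y ^ k) (i : ZMod n) : c i * x = x * c (-i) := by
  have h0 : c 0 = 1 := by simpa using hk 0
  have hneg : c (-i) = (c i)⁻¹ := eq_inv_of_mul_eq_one_left (by rw [← hc, neg_add_cancel, h0])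
  have : SemiconjBy x y⁻¹ y := hxy.symm
  rw [hneg, ← ZMod.natCast_zmod_val i, hk, ← inv_pow]
  exact (this.pow_right _).symm

/-- The universal property of the dihedral group. -/
theorem DihedralGroup.exists_hom {E : Type*} [Group E] {n : ℕ} [NeZero n] {x y : E}
    (hx : x ^ 2 = 1) (hy : y ^ n = 1) (hxy : y * x = x * y⁻¹) :
    ∃ f : DihedralGroup n →* E, f (.sr 0) = x ∧ f (.r 1) = y := by
  obtain ⟨c, hc, hc1, hk⟩ := exists_zmod_powers_hom hy
  have hcx := zmod_powers_mul_of_inverts hxy hc hk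
  have h0 : c 0 = 1 := by simpa using hk 0
  refine ⟨MonoidHom.mk' (fun | .r i => c i | .sr i => x * c i) ?_, ?_, ?_⟩
  · rintro (i | i) (j | j)
    · exact hc i j
    · simp only [DihedralGroup.r_mul_sr]
      rw [← mul_assoc, hcx, mul_assoc, ← hc, neg_add_eq_sub]
    · simp only [DihedralGroup.sr_mul_r]
      rw [hc, mul_assoc]
    · simp only [DihedralGroup.sr_mul_sr]
      rw [mul_assoc, ← mul_assoc (c i), hcx, mul_assoc x, ← mul_assoc x x, ← pow_two, hx, one_mul,
        ← hc, neg_add_eq_sub]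
  · simp [h0]
  · simpa using hc1

theorem DihedralGroup.hom_ext {E : Type*} [Group E] {n : ℕ} [NeZero n]
    {f g : DihedralGroup n →* E} (hs : f (.sr 0) = g (.sr 0)) (hr : f (.r 1) = g (.r 1)) :
    f = g := by
  have h : ∀ i, f (.r i) = g (.r i) := fun i => by
    rw [← ZMod.natCast_zmod_val i, ← DihedralGroup.r_one_pow, map_pow, map_pow, hr]
  ext (i | i)
  · exact h i
  · have : (DihedralGroup.sr i : DihedralGroup n) = .sr 0 * .r i := by simp
    rw [this, map_mul, map_mul, hs, h]

/-- The universal property of the generalized quaternion group. -/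
theorem QuaternionGroup.exists_hom {E : Type*} [Group E] {n : ℕ} [NeZero n] {x y : E}
    (hx : x ^ 2 = y ^ n) (hy : y ^ (2 * n) = 1) (hxy : y * x = x * y⁻¹) :
    ∃ f : QuaternionGroup n →* E, f (.xa 0) = x ∧ f (.a 1) = y := by
  obtain ⟨c, hc, hc1, hk⟩ := exists_zmod_powers_hom hy
  have hcx := zmod_powers_mul_of_inverts hxy hc hk
  have h0 : c 0 = 1 := by simpa using hk 0
  refine ⟨MonoidHom.mk' (fun | .a i => c i | .xa i => x * c i) ?_, ?_, ?_⟩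
  · rintro (i | i) (j | j)
    · exact hc i j
    · simp only [QuaternionGroup.a_mul_xa]
      rw [← mul_assoc, hcx, mul_assoc, ← hc, neg_add_eq_sub]
    · simp only [QuaternionGroup.xa_mul_a]
      rw [hc, mul_assoc]
    · simp only [QuaternionGroup.xa_mul_xa]
      rw [mul_assoc, ← mul_assoc (c i), hcx, mul_assoc x, ← mul_assoc x x, ← pow_two, hx, ← hk,
        ← hc, ← hc, neg_add_eq_sub, add_sub_assoc]
  · simp [h0]
  · simpa using hc1

theorem QuaternionGroup.hom_ext {E : Type*} [Group E] {n : ℕ} [NeZero n]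
    {f g : QuaternionGroup n →* E} (hs : f (.xa 0) = g (.xa 0)) (hr : f (.a 1) = g (.a 1)) :
    f = g := by
  have h : ∀ i, f (.a i) = g (.a i) := fun i => by
    rw [← ZMod.natCast_zmod_val i, ← QuaternionGroup.a_one_pow, map_pow, map_pow, hr]
  ext (i | i)
  · exact h i
  · have : (QuaternionGroup.xa i : QuaternionGroup n) = .xa 0 * .a i := by simp
    rw [this, map_mul, map_mul, hs, h]

/-- The relators of the dihedral group of order `2 * n`. -/
def dihedralRelators (n : ℕ) : Fin 3 → FreeGroup (Fin 2) :=
  ![.of 0 ^ 2, .of 1 ^ n, (.of 1 * .of 0) * (.of 0 * (.of 1)⁻¹)⁻¹]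

/-- Relators of the generalized quaternion group of order `4 * n`. -/
def quaternionRelators (n : ℕ) : Fin 3 → FreeGroup (Fin 2) :=
  ![.of 0 ^ 2 * (.of 1 ^ n)⁻¹, .of 1 ^ (2 * n), (.of 1 * .of 0) * (.of 0 * (.of 1)⁻¹)⁻¹]

theorem DihedralGroup.nonempty_equiv_presentedGroup (n : ℕ) [NeZero n] :
    Nonempty (DihedralGroup n ≃* PresentedGroup (Set.range (dihedralRelators n))) := by
  have hr : ∀ i, PresentedGroup.mk (Set.range (dihedralRelators n)) (dihedralRelators n i) = 1 :=
    fun i => PresentedGroup.one_of_mem ⟨i, rfl⟩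
  obtain ⟨f, hf0, hf1⟩ := DihedralGroup.exists_hom (n := n)
    (x := PresentedGroup.mk (Set.range (dihedralRelators n)) (.of 0))
    (y := PresentedGroup.mk (Set.range (dihedralRelators n)) (.of 1))
    (hr 0) (hr 1) (mul_inv_eq_one.1 (hr 2))
  have hg : ∀ s ∈ Set.range (dihedralRelators n),
      FreeGroup.lift ![(.sr 0 : DihedralGroup n), .r 1] s = 1 := by
    rintro _ ⟨i, rfl⟩
    fin_cases i <;> simp [dihedralRelators, pow_two]
  refine ⟨MonoidHom.toMulEquiv f (PresentedGroup.toGroup hg) ?_ ?_⟩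
  · apply DihedralGroup.hom_ext
    · rw [MonoidHom.comp_apply, hf0]
      exact PresentedGroup.toGroup.of hg
    · rw [MonoidHom.comp_apply, hf1]
      exact PresentedGroup.toGroup.of hg
  · refine PresentedGroup.ext fun a => ?_
    rw [MonoidHom.comp_apply, PresentedGroup.toGroup.of]
    fin_cases a
    · exact hf0
    · exact hf1

theorem QuaternionGroup.nonempty_equiv_presentedGroup (n : ℕ) [NeZero n] :
    Nonempty (QuaternionGroup n ≃* PresentedGroup (Set.range (quaternionRelators n))) := by
  have hr : ∀ i,
      PresentedGroup.mk (Set.range (quaternionRelators n)) (quaternionRelators n i) = 1 :=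
    fun i => PresentedGroup.one_of_mem ⟨i, rfl⟩
  obtain ⟨f, hf0, hf1⟩ := QuaternionGroup.exists_hom (n := n)
    (x := PresentedGroup.mk (Set.range (quaternionRelators n)) (.of 0))
    (y := PresentedGroup.mk (Set.range (quaternionRelators n)) (.of 1))
    (mul_inv_eq_one.1 (hr 0)) (hr 1) (mul_inv_eq_one.1 (hr 2))
  have hg : ∀ s ∈ Set.range (quaternionRelators n),
      FreeGroup.lift ![(.xa 0 : QuaternionGroup n), .a 1] s = 1 := by
    rintro _ ⟨i, rfl⟩
    fin_cases i
    · simp [quaternionRelators]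
    · simp [quaternionRelators]
    · have : (QuaternionGroup.a 1 : QuaternionGroup n)⁻¹ = .a (-1) := rfl
      simp only [quaternionRelators, Fin.reduceFinMk, Matrix.cons_val, map_mul, map_inv,
        FreeGroup.lift_apply_of, mul_inv_eq_one, Matrix.cons_val_zero, Matrix.cons_val_one, this]
      simp
  refine ⟨MonoidHom.toMulEquiv f (PresentedGroup.toGroup hg) ?_ ?_⟩
  · apply QuaternionGroup.hom_ext
    · rw [MonoidHom.comp_apply, hf0]
      exact PresentedGroup.toGroup.of hg
    · rw [MonoidHom.comp_apply, hf1]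
      exact PresentedGroup.toGroup.of hg
  · refine PresentedGroup.ext fun a => ?_
    rw [MonoidHom.comp_apply, PresentedGroup.toGroup.of]
    fin_cases a
    · exact hf0
    · exact hf1

theorem exists_presentation_three_relators {P : Type*} [Group P]
    (hP : IsDihedralTwoGroup P ∨ IsSemidihedralTwoGroup P ∨ IsGeneralizedQuaternionTwoGroup P) :
    ∃ r : Fin 3 → FreeGroup (Fin 2), Nonempty (P ≃* PresentedGroup (Set.range r)) := by
  obtain ⟨m, -, ⟨e⟩⟩ | ⟨m, -, ⟨e⟩⟩ | ⟨m, -, ⟨e⟩⟩ := hP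
  · obtain ⟨e'⟩ := DihedralGroup.nonempty_equiv_presentedGroup (2 ^ m)
    exact ⟨_, ⟨e.trans e'⟩⟩
  · refine ⟨![.of 0 ^ 2, .of 1 ^ (2 ^ m),
      (.of 1 * .of 0) * (.of 0 * .of 1 ^ (2 ^ (m - 1) - 1))⁻¹], ?_⟩
    have : Set.range ![.of 0 ^ 2, .of 1 ^ (2 ^ m),
        (.of 1 * .of 0) * (.of 0 * .of 1 ^ (2 ^ (m - 1) - 1))⁻¹] = semidihedralRels m := by
      simp only [Matrix.range_cons, Matrix.range_empty, Set.union_empty, semidihedralRels]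
      rfl
    rw [this]
    exact ⟨e⟩
  -- The relator `y ^ (2 * n)` follows from the other two, but three are affordable.
  · obtain ⟨e'⟩ := QuaternionGroup.nonempty_equiv_presentedGroup (2 ^ (m - 1))
    exact ⟨_, ⟨e.trans e'⟩⟩

/-! ### The dimension bound -/

/-- If a subgroup of invertible finite index has a presentation with relators indexed by `ι`, then
the second cohomology of `M` has rank at most that of `ι → M`. -/
theorem rank_H2_le_of_subgroup_presentation {F Q : Type u} [Field F] [Group Q] (P : Subgroup Q)
    [Finite (Q ⧸ P)] (hP : (P.index : F) ≠ 0) {α ι : Type} {r : ι → FreeGroup α}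
    (e : P ≃* PresentedGroup (Set.range r)) (M : Rep.{u} F Q) :
    Module.rank F (groupCohomology.H2 M) ≤ Module.rank F (ι → M) := by
  have hc : ∀ (n : groupCohomology.cocycles₂ M) (g h j : Q),
      n (g * h, j) + n (g, h) = M.ρ g (n (h, j)) + n (g, h * j) := fun n =>
    (groupCohomology.mem_cocycles₂_iff (n : Q × Q → M)).1 n.2
  obtain ⟨L, hL⟩ := exists_linearMap_of_presentation e (M.ρ.comp P.subtype)
    (fun g h => (LinearMap.proj ((g : Q), (h : Q))).comp (groupCohomology.cocycles₂ M).subtype)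
    (fun n g h j => hc n g h j)
  have hker : LinearMap.ker L ≤ LinearMap.ker (groupCohomology.H2π M).hom := by
    intro n hn
    obtain ⟨φ, hφ⟩ := hL n hn
    obtain ⟨ψ, hψ⟩ := exists_coboundary_of_subgroup M.ρ P hP (fun g h => n (g, h)) (hc n) φ hφ
    refine (groupCohomology.H2π_eq_zero_iff n).2 ⟨ψ, ?_⟩
    ext ⟨g, h⟩
    exact (hψ g h).symm
  have hsurj : Function.Surjective (groupCohomology.H2π M).hom :=
    (ModuleCat.epi_iff_surjective _).1 inferInstance
  -- The projection to `H²` factors through the range of `L`; over a field it extends to all of `ι →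
  -- M`, and the extension is still surjective.
  obtain ⟨R, hR⟩ := LinearMap.exists_extend
    (((LinearMap.ker L).liftQ (groupCohomology.H2π M).hom hker).comp
      L.quotKerEquivRange.symm.toLinearMap)
  refine LinearMap.rank_le_of_surjective R fun z => ?_
  obtain ⟨n, rfl⟩ := hsurj z
  refine ⟨L n, ?_⟩
  have h := LinearMap.congr_fun hR ⟨L n, n, rfl⟩
  refine h.trans ?_
  have h' : L.quotKerEquivRange.symm ⟨L n, n, rfl⟩ = Submodule.Quotient.mk n :=
    L.quotKerEquivRange.symm_apply_eq.2 rfl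
  rw [LinearMap.comp_apply, LinearEquiv.coe_coe, h']
  rfl

theorem mainTheorem4 {F : Type u} [Field F] [CharP F 2] {Q : Type u} [Group Q] [Finite Q]
    (P : Sylow 2 Q)
    (hP : IsDihedralTwoGroup (P : Subgroup Q) ∨ IsSemidihedralTwoGroup (P : Subgroup Q) ∨
      IsGeneralizedQuaternionTwoGroup (P : Subgroup Q))
    (M : Rep.{u} F Q) :
    Module.rank F (groupCohomology.H2 M) ≤ 3 * Module.rank F M := by
  obtain ⟨r, ⟨e⟩⟩ := exists_presentation_three_relators hP
  have hidx : ((P : Subgroup Q).index : F) ≠ 0 := by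
    rw [Ne, CharP.cast_eq_zero_iff F 2]
    exact P.not_dvd_index
  refine (rank_H2_le_of_subgroup_presentation (P : Subgroup Q) hidx e M).trans ?_
  simp
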